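/- Let $n\ge 1$ and let $(M,g)$ be a compact $n$-dimensional Riemannian manifold (smooth, Hausdorff, without boundary, not necessarily connected, with a smooth Riemannian metric $g$). Put $q=\frac n2(n+5)$. Then there exists a free embedding $F_0\in C^\infty(M,\mathbb R^{q})$ such that $g-F_0^*(g^{can})$ is a (smooth) Riemannian metric on $M$. Here $g^{can}$ is the standard Riemannian metric of $\mathbb R^q$. A map $F\in C^\infty(M,\mathbb R^q)$ is called free if for every $p\in M$ and every chart $\varphi$ of $M$ around $p$ the linear span in $\mathbb R^q$ of the vectors $\partial_i(F\circ\varphi^{-1})(\varphi(p))$, $1\le i\le n$, and $\partial_i\partial_j(F\circ\varphi^{-1})(\varphi(p))$, $1\le i\le j\le n$, has the maximal possible dimension $\frac n2(n+3)$ (this span does not depend on the chart). A free embedding is a free map that is a smooth embedding, i.e. an immersion (a smooth map whose differential is injective at every point) and a homeomorphism onto its image. -/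

import Mathlib

open scoped Manifold ContDiff

noncomputable section

/-- The partial derivative `∂ᵢ f (x)` of a map `f : ℝⁿ → ℝ^q` in the `i`-th coordinate
direction. -/
def partialDeriv {n q : ℕ} (i : Fin n)
    (f : EuclideanSpace ℝ (Fin n) → EuclideanSpace ℝ (Fin q))
    (x : EuclideanSpace ℝ (Fin n)) : EuclideanSpace ℝ (Fin q) :=
  fderiv ℝ f x (EuclideanSpace.single i 1)

/-- The space of all derivatives of `F : M → ℝ^q` up to order two at `p`, with respect to the
chart `φ`: the linear span in `ℝ^q` of all `∂ᵢ (F ∘ φ⁻¹) (φ p)` and of all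
`∂ᵢ ∂ⱼ (F ∘ φ⁻¹) (φ p)` with `i ≤ j`. -/
def derivSpaceTwo {n q : ℕ} {M : Type*} [TopologicalSpace M]
    (φ : OpenPartialHomeomorph M (EuclideanSpace ℝ (Fin n)))
    (F : M → EuclideanSpace ℝ (Fin q)) (p : M) :
    Submodule ℝ (EuclideanSpace ℝ (Fin q)) :=
  Submodule.span ℝ
    ({v | ∃ i : Fin n, v = partialDeriv i (F ∘ φ.symm) (φ p)} ∪
      {v | ∃ i j : Fin n, i ≤ j ∧
        v = partialDeriv i (partialDeriv j (F ∘ φ.symm)) (φ p)})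

/-- A map `F : M → ℝ^q` on a smooth `n`-dimensional manifold is *free* if it is smooth and at
every point the space of its derivatives up to order two has the maximal possible dimension
`n (n + 3) / 2` (an integer). That space does not depend on the chart around the point; the
condition is imposed in every chart of the smooth structure. -/
structure IsFreeMap (n : ℕ) {q : ℕ} {M : Type*} [TopologicalSpace M]
    [ChartedSpace (EuclideanSpace ℝ (Fin n)) M]
    (F : M → EuclideanSpace ℝ (Fin q)) : Prop where
  contMDiff : ContMDiff (𝓡 n) (𝓡 q) ∞ F
  finrank_eq : ∀ p : M, ∀ φ ∈ IsManifold.maximalAtlas (𝓡 n) ∞ M, p ∈ φ.source →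
    Module.finrank ℝ (derivSpaceTwo φ F p) = n * (n + 3) / 2

/-- A *free embedding*: a free map which is a smooth embedding, that is, an immersion (its
differential is injective at every point) and a homeomorphism onto its image. -/
structure IsFreeEmbedding (n : ℕ) {q : ℕ} {M : Type*} [TopologicalSpace M]
    [ChartedSpace (EuclideanSpace ℝ (Fin n)) M]
    (F : M → EuclideanSpace ℝ (Fin q)) : Prop extends IsFreeMap n F where
  injective_mfderiv : ∀ p : M, Function.Injective (mfderiv (𝓡 n) (𝓡 q) F p)
  isEmbedding : Topology.IsEmbedding F

/-- The pullback `F^* g^can` of the standard Riemannian metric of `ℝ^q`, at the point `p` and on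
the tangent vectors `X, Y` of `M` at `p`: the number `g^can (dF_p X, dF_p Y)`. -/
def pullbackCan (n : ℕ) {q : ℕ} {M : Type*} [TopologicalSpace M]
    [ChartedSpace (EuclideanSpace ℝ (Fin n)) M]
    (F : M → EuclideanSpace ℝ (Fin q)) (p : M) (X Y : TangentSpace (𝓡 n) p) : ℝ :=
  (riemannianMetricVectorSpace (EuclideanSpace ℝ (Fin q))).inner (F p)
    (mfderiv (𝓡 n) (𝓡 q) F p X) (mfderiv (𝓡 n) (𝓡 q) F p Y)

end

/-! Embed `M` into some `ℝ^k` by Whitney's theorem and append all products of two coordinates. The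
resulting map is free: where an immersion supplies enough first derivatives, products of coordinates
separate the second derivatives (`linearIndependent_jetTwo_veroneseMap_comp`).

The target dimension is then lowered one at a time by projecting along a vector `v`. The projection
preserves freeness if `v` lies in no second-order derivative space, and injectivity if no secant of
the image is parallel to `v`. The derivative spaces sweep out a set of Hausdorff dimension at most
`n + n(n+3)/2 = n(n+5)/2`, and the multiples of secants one of dimension at most `2n + 1`, which is
no larger as `n ≥ 1`. So a good `v` exists whenever the ambient dimension exceeds `n(n+5)/2`
(`exists_isFreeMap_injective_of_succ`).

Finally, freeness and injectivity survive scaling by `ε ≠ 0`, while the pullback metric is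
multiplied by `ε²`. By compactness a small `ε` brings it below `g / 2`, and the difference is then
positive definite. -/

open Topology Bundle

/-! ### Jets and osculating spaces in coordinates -/

/-- The index type of the derivatives of order one and two in `n` variables. -/
abbrev JetIndex (n : ℕ) : Type := Fin n ⊕ {p : Fin n × Fin n // p.1 ≤ p.2}

/-- The family of all partial derivatives of order one and two of `f` at `x`. -/
noncomputable def jetTwo {n q : ℕ} (f : EuclideanSpace ℝ (Fin n) → EuclideanSpace ℝ (Fin q))
    (x : EuclideanSpace ℝ (Fin n)) : JetIndex n → EuclideanSpace ℝ (Fin q) :=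
  Sum.elim (fun i => partialDeriv i f x) (fun p => partialDeriv p.1.1 (partialDeriv p.1.2 f) x)

theorem card_jetIndex (n : ℕ) : Fintype.card (JetIndex n) = n * (n + 3) / 2 := by
  rw [Fintype.card_sum, Fintype.card_fin, ← Fintype.card_congr (Sym2.sortEquiv (α := Fin n)),
    Sym2.card, Fintype.card_fin, Nat.choose_two_right, Nat.add_sub_cancel]
  have h : n * (n + 3) = (n + 1) * n + n * 2 := by ring
  rw [h, Nat.add_mul_div_right _ _ two_pos, add_comm]

theorem derivSpaceTwo_eq_span_range {n q : ℕ} {M : Type*} [TopologicalSpace M]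
    (φ : OpenPartialHomeomorph M (EuclideanSpace ℝ (Fin n)))
    (F : M → EuclideanSpace ℝ (Fin q)) (p : M) :
    derivSpaceTwo φ F p = Submodule.span ℝ (Set.range (jetTwo (F ∘ φ.symm) (φ p))) := by
  unfold derivSpaceTwo jetTwo
  rw [Set.Sum.elim_range]
  congr 2
  · ext v; simp [eq_comm]
  · ext v
    constructor
    · rintro ⟨i, j, h, rfl⟩
      exact ⟨⟨(i, j), h⟩, rfl⟩
    · rintro ⟨⟨⟨i, j⟩, h⟩, rfl⟩
      exact ⟨i, j, h, rfl⟩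

/-- The number `n(n+3)/2` is exactly the number of generators, so maximal dimension means that no
linear relation holds among them. -/
theorem finrank_derivSpaceTwo_eq_iff {n q : ℕ} {M : Type*} [TopologicalSpace M]
    (φ : OpenPartialHomeomorph M (EuclideanSpace ℝ (Fin n)))
    (F : M → EuclideanSpace ℝ (Fin q)) (p : M) :
    Module.finrank ℝ (derivSpaceTwo φ F p) = n * (n + 3) / 2 ↔
      LinearIndependent ℝ (jetTwo (F ∘ φ.symm) (φ p)) := by
  rw [linearIndependent_iff_card_eq_finrank_span, Set.finrank, card_jetIndex,
    derivSpaceTwo_eq_span_range, eq_comm]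

/-- The span of the values of the first and second Fréchet derivatives of `f` at `x`. -/
noncomputable def osculatingSpace {E F : Type*} [NormedAddCommGroup E] [NormedSpace ℝ E]
    [NormedAddCommGroup F] [NormedSpace ℝ F] (f : E → F) (x : E) : Submodule ℝ F :=
  Submodule.span ℝ (Set.range (fderiv ℝ f x) ∪
    Set.range (fun u : E × E => fderiv ℝ (fderiv ℝ f) x u.1 u.2))

theorem ContDiffAt.differentiableAt_fderiv {E F : Type*} [NormedAddCommGroup E] [NormedSpace ℝ E]
    [NormedAddCommGroup F] [NormedSpace ℝ F] {f : E → F} {x : E} (hf : ContDiffAt ℝ 2 f x) :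
    DifferentiableAt ℝ (fderiv ℝ f) x :=
  (hf.fderiv_right (m := 1) (by norm_num)).differentiableAt one_ne_zero

theorem partialDeriv_partialDeriv {n q : ℕ}
    {f : EuclideanSpace ℝ (Fin n) → EuclideanSpace ℝ (Fin q)}
    {x : EuclideanSpace ℝ (Fin n)} (hf : ContDiffAt ℝ 2 f x) (i j : Fin n) :
    partialDeriv i (partialDeriv j f) x =
      fderiv ℝ (fderiv ℝ f) x (EuclideanSpace.single i 1) (EuclideanSpace.single j 1) := by
  unfold partialDeriv
  rw [fderiv_clm_apply hf.differentiableAt_fderiv (differentiableAt_const _)]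
  simp

/-- Symmetry of the second derivative makes the pairs with `i ≤ j` sufficient. The right-hand side
is coordinate-free, which suits changes of chart. -/
theorem span_range_jetTwo {n q : ℕ} {f : EuclideanSpace ℝ (Fin n) → EuclideanSpace ℝ (Fin q)}
    {x : EuclideanSpace ℝ (Fin n)} (hf : ContDiffAt ℝ 2 f x) :
    Submodule.span ℝ (Set.range (jetTwo f x)) = osculatingSpace f x := by
  have hmem (c : JetIndex n) : jetTwo f x c ∈ Submodule.span ℝ (Set.range (jetTwo f x)) :=
    Submodule.subset_span ⟨c, rfl⟩
  have hsum (u : EuclideanSpace ℝ (Fin n)) :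
      u = ∑ i, u i • (EuclideanSpace.single i 1 : EuclideanSpace ℝ (Fin n)) := by
    ext j
    simp [Pi.single_apply]
  apply le_antisymm
  · refine Submodule.span_le.2 ?_
    rintro _ ⟨i | p, rfl⟩
    · exact Submodule.subset_span (Or.inl ⟨_, rfl⟩)
    · simp only [jetTwo, Sum.elim_inr, partialDeriv_partialDeriv hf]
      exact Submodule.subset_span (Or.inr ⟨(_, _), rfl⟩)
  · have hD2 (i j : Fin n) :
        fderiv ℝ (fderiv ℝ f) x (EuclideanSpace.single i 1) (EuclideanSpace.single j 1) ∈
          Submodule.span ℝ (Set.range (jetTwo f x)) := by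
      rcases le_total i j with h | h
      · rw [← partialDeriv_partialDeriv hf]
        exact hmem (Sum.inr ⟨(i, j), h⟩)
      · rw [hf.isSymmSndFDerivAt (by simp) _ _, ← partialDeriv_partialDeriv hf]
        exact hmem (Sum.inr ⟨(j, i), h⟩)
    refine Submodule.span_le.2 (Set.union_subset ?_ ?_)
    · rintro _ ⟨u, rfl⟩
      rw [hsum u, map_sum]
      refine Submodule.sum_mem _ fun i _ => ?_
      rw [map_smul]
      exact Submodule.smul_mem _ _ (hmem (Sum.inl i))
    · rintro _ ⟨⟨u, w⟩, rfl⟩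
      dsimp only
      rw [hsum w, map_sum]
      refine Submodule.sum_mem _ fun j _ => ?_
      rw [map_smul, hsum u, map_sum, sum_apply]
      refine Submodule.smul_mem _ _ (Submodule.sum_mem _ fun i _ => ?_)
      rw [map_smul, smul_apply]
      exact Submodule.smul_mem _ _ (hD2 i j)

/-- Second-order chain rule: `D²(f ∘ τ)(u, w) = Df (D²τ(u, w)) + D²f (Dτ u, Dτ w)`, and both
summands lie in the osculating space of `f`. -/
theorem osculatingSpace_comp_le {E E' F : Type*} [NormedAddCommGroup E] [NormedSpace ℝ E]
    [NormedAddCommGroup E'] [NormedSpace ℝ E'] [NormedAddCommGroup F] [NormedSpace ℝ F]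
    {f : E' → F} {τ : E → E'} {x : E} (hf : ContDiffAt ℝ 2 f (τ x)) (hτ : ContDiffAt ℝ 2 τ x) :
    osculatingSpace (f ∘ τ) x ≤ osculatingSpace f (τ x) := by
  have hev : fderiv ℝ (f ∘ τ) =ᶠ[𝓝 x] fun y => (fderiv ℝ f (τ y)).comp (fderiv ℝ τ y) := by
    filter_upwards [hτ.eventually (by simp), hτ.continuousAt.eventually (hf.eventually (by simp))]
      with y h1 h2
    exact fderiv_comp y (h2.differentiableAt two_ne_zero) (h1.differentiableAt two_ne_zero)
  have h2 (u w : E) : fderiv ℝ (fderiv ℝ (f ∘ τ)) x u w =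
      fderiv ℝ f (τ x) (fderiv ℝ (fderiv ℝ τ) x u w) +
        fderiv ℝ (fderiv ℝ f) (τ x) (fderiv ℝ τ x u) (fderiv ℝ τ x w) := by
    have hc : DifferentiableAt ℝ (fun y => fderiv ℝ f (τ y)) x :=
      hf.differentiableAt_fderiv.comp x (hτ.differentiableAt two_ne_zero)
    rw [hev.fderiv_eq, fderiv_clm_comp hc hτ.differentiableAt_fderiv]
    have := fderiv_comp x hf.differentiableAt_fderiv (hτ.differentiableAt two_ne_zero)
    simp only [Function.comp_def] at this
    simp [this]
  refine Submodule.span_le.2 (Set.union_subset ?_ ?_)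
  · rintro _ ⟨u, rfl⟩
    rw [hev.eq_of_nhds]
    exact Submodule.subset_span (Or.inl ⟨_, rfl⟩)
  · rintro _ ⟨⟨u, w⟩, rfl⟩
    dsimp only
    rw [h2]
    exact Submodule.add_mem _ (Submodule.subset_span (Or.inl ⟨_, rfl⟩))
      (Submodule.subset_span (Or.inr ⟨(_, _), rfl⟩))

theorem partialDeriv_clm_comp {n q r : ℕ}
    {f : EuclideanSpace ℝ (Fin n) → EuclideanSpace ℝ (Fin q)} {x : EuclideanSpace ℝ (Fin n)}
    (hf : DifferentiableAt ℝ f x) (A : EuclideanSpace ℝ (Fin q) →L[ℝ] EuclideanSpace ℝ (Fin r))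
    (i : Fin n) : partialDeriv i (A ∘ f) x = A (partialDeriv i f x) := by
  unfold partialDeriv
  rw [fderiv_comp x A.differentiableAt hf, A.fderiv]
  rfl

theorem ContDiffAt.differentiableAt_partialDeriv {n q : ℕ}
    {f : EuclideanSpace ℝ (Fin n) → EuclideanSpace ℝ (Fin q)} {x : EuclideanSpace ℝ (Fin n)}
    (hf : ContDiffAt ℝ 2 f x) (i : Fin n) : DifferentiableAt ℝ (partialDeriv i f) x :=
  hf.differentiableAt_fderiv.clm_apply (differentiableAt_const _)

theorem jetTwo_clm_comp {n q r : ℕ}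
    {f : EuclideanSpace ℝ (Fin n) → EuclideanSpace ℝ (Fin q)} {x : EuclideanSpace ℝ (Fin n)}
    (hf : ContDiffAt ℝ 2 f x)
    (A : EuclideanSpace ℝ (Fin q) →L[ℝ] EuclideanSpace ℝ (Fin r)) :
    jetTwo (A ∘ f) x = A ∘ jetTwo f x := by
  funext c
  rcases c with i | ⟨⟨i, j⟩, h⟩
  · exact partialDeriv_clm_comp (hf.differentiableAt two_ne_zero) A i
  · have hev : partialDeriv j (A ∘ f) =ᶠ[𝓝 x] A ∘ partialDeriv j f := by
      filter_upwards [hf.eventually (by simp)] with y hy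
      exact partialDeriv_clm_comp (hy.differentiableAt two_ne_zero) A j
    change partialDeriv i (partialDeriv j (A ∘ f)) x = A (partialDeriv i (partialDeriv j f) x)
    rw [← partialDeriv_clm_comp (hf.differentiableAt_partialDeriv j)]
    unfold partialDeriv at hev ⊢
    rw [hev.fderiv_eq]

/-! ### Second-order product rule and the Veronese map -/

/-- The partial derivative of a real-valued function in the `i`-th coordinate direction. -/
noncomputable def scalarPartialDeriv {n : ℕ} (i : Fin n) (h : EuclideanSpace ℝ (Fin n) → ℝ)
    (x : EuclideanSpace ℝ (Fin n)) : ℝ :=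
  fderiv ℝ h x (EuclideanSpace.single i 1)

theorem partialDeriv_apply {n q : ℕ} {f : EuclideanSpace ℝ (Fin n) → EuclideanSpace ℝ (Fin q)}
    {x : EuclideanSpace ℝ (Fin n)} (hf : DifferentiableAt ℝ f x) (i : Fin n) (c : Fin q) :
    partialDeriv i f x c = scalarPartialDeriv i (fun y => f y c) x := by
  have h := ((EuclideanSpace.proj (𝕜 := ℝ) c).hasFDerivAt.comp x hf.hasFDerivAt).fderiv
  exact (congrArg (fun A : EuclideanSpace ℝ (Fin n) →L[ℝ] ℝ => A (EuclideanSpace.single i 1))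
    h).symm

theorem partialDeriv_partialDeriv_apply {n q : ℕ}
    {f : EuclideanSpace ℝ (Fin n) → EuclideanSpace ℝ (Fin q)} {x : EuclideanSpace ℝ (Fin n)}
    (hf : ContDiffAt ℝ 2 f x) (i j : Fin n) (c : Fin q) :
    partialDeriv i (partialDeriv j f) x c =
      scalarPartialDeriv i (scalarPartialDeriv j (fun y => f y c)) x := by
  rw [partialDeriv_apply (hf.differentiableAt_partialDeriv j)]
  have hev : (fun y => partialDeriv j f y c) =ᶠ[𝓝 x] scalarPartialDeriv j (fun y => f y c) := by
    filter_upwards [hf.eventually (by simp)] with y hy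
    exact partialDeriv_apply (hy.differentiableAt two_ne_zero) j c
  unfold scalarPartialDeriv at hev ⊢
  rw [hev.fderiv_eq]

theorem scalarPartialDeriv_mul {n : ℕ} {a b : EuclideanSpace ℝ (Fin n) → ℝ}
    {x : EuclideanSpace ℝ (Fin n)} (ha : DifferentiableAt ℝ a x) (hb : DifferentiableAt ℝ b x)
    (i : Fin n) :
    scalarPartialDeriv i (fun y => a y * b y) x =
      a x * scalarPartialDeriv i b x + b x * scalarPartialDeriv i a x := by
  unfold scalarPartialDeriv
  rw [fderiv_fun_mul ha hb]
  simp

theorem ContDiffAt.differentiableAt_scalarPartialDeriv {n : ℕ}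
    {a : EuclideanSpace ℝ (Fin n) → ℝ} {x : EuclideanSpace ℝ (Fin n)}
    (ha : ContDiffAt ℝ 2 a x) (i : Fin n) : DifferentiableAt ℝ (scalarPartialDeriv i a) x :=
  ha.differentiableAt_fderiv.clm_apply (differentiableAt_const _)

theorem scalarPartialDeriv_scalarPartialDeriv_mul {n : ℕ} {a b : EuclideanSpace ℝ (Fin n) → ℝ}
    {x : EuclideanSpace ℝ (Fin n)} (ha : ContDiffAt ℝ 2 a x) (hb : ContDiffAt ℝ 2 b x)
    (i j : Fin n) :
    scalarPartialDeriv i (scalarPartialDeriv j (fun y => a y * b y)) x =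
      a x * scalarPartialDeriv i (scalarPartialDeriv j b) x +
      b x * scalarPartialDeriv i (scalarPartialDeriv j a) x +
      (scalarPartialDeriv i a x * scalarPartialDeriv j b x +
        scalarPartialDeriv j a x * scalarPartialDeriv i b x) := by
  have hev : scalarPartialDeriv j (fun y => a y * b y) =ᶠ[𝓝 x]
      fun y => a y * scalarPartialDeriv j b y + b y * scalarPartialDeriv j a y := by
    filter_upwards [ha.eventually (by simp), hb.eventually (by simp)] with y h1 h2
    exact scalarPartialDeriv_mul (h1.differentiableAt two_ne_zero)
      (h2.differentiableAt two_ne_zero) j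
  have hda := ha.differentiableAt two_ne_zero
  have hdb := hb.differentiableAt two_ne_zero
  have hja := ha.differentiableAt_scalarPartialDeriv j
  have hjb := hb.differentiableAt_scalarPartialDeriv j
  have hsum : scalarPartialDeriv i (scalarPartialDeriv j (fun y => a y * b y)) x =
      scalarPartialDeriv i (fun y => a y * scalarPartialDeriv j b y) x +
        scalarPartialDeriv i (fun y => b y * scalarPartialDeriv j a y) x := by
    conv_lhs => unfold scalarPartialDeriv
    unfold scalarPartialDeriv at hev hja hjb ⊢
    rw [hev.fderiv_eq, fderiv_fun_add (hda.fun_mul hjb) (hdb.fun_mul hja)]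
    rfl
  rw [hsum, scalarPartialDeriv_mul hda hjb, scalarPartialDeriv_mul hdb hja]
  ring

/-- The map `y ↦ (yₐ, yₐ y_b)` collecting all coordinates and all products of two coordinates. -/
noncomputable def veroneseMap (k : ℕ) (y : EuclideanSpace ℝ (Fin k)) :
    EuclideanSpace ℝ (Fin (Fintype.card (Fin k ⊕ Fin k × Fin k))) :=
  WithLp.toLp 2 fun c => Sum.elim (fun a => y a) (fun ab : Fin k × Fin k => y ab.1 * y ab.2)
    ((Fintype.equivFin _).symm c)

theorem veroneseMap_apply_inl {k : ℕ} (y : EuclideanSpace ℝ (Fin k)) (a : Fin k) :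
    veroneseMap k y (Fintype.equivFin _ (Sum.inl a)) = y a := by
  simp [veroneseMap]

theorem veroneseMap_apply_inr {k : ℕ} (y : EuclideanSpace ℝ (Fin k)) (a b : Fin k) :
    veroneseMap k y (Fintype.equivFin _ (Sum.inr (a, b))) = y a * y b := by
  simp [veroneseMap]

theorem veroneseMap_injective (k : ℕ) : Function.Injective (veroneseMap k) := fun y z h => by
  ext a
  rw [← veroneseMap_apply_inl y a, h, veroneseMap_apply_inl]

theorem contDiff_veroneseMap (k : ℕ) {m : WithTop ℕ∞} : ContDiff ℝ m (veroneseMap k) := by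
  refine contDiff_euclidean.2 fun c => ?_
  have hco (a : Fin k) : ContDiff ℝ m fun y : EuclideanSpace ℝ (Fin k) => y a :=
    (EuclideanSpace.proj (𝕜 := ℝ) a).contDiff
  obtain ⟨a | ⟨a, b⟩, rfl⟩ := (Fintype.equivFin _).surjective c
  · simpa only [veroneseMap_apply_inl] using hco a
  · simpa only [veroneseMap_apply_inr] using (hco a).mul (hco b)

/-- The composition of an immersion with the Veronese map is free. -/
theorem linearIndependent_jetTwo_veroneseMap_comp {n k : ℕ}
    {u : EuclideanSpace ℝ (Fin n) → EuclideanSpace ℝ (Fin k)} {x : EuclideanSpace ℝ (Fin n)}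
    (hu : ContDiffAt ℝ 2 u x) (hinj : Function.Injective (fderiv ℝ u x)) :
    LinearIndependent ℝ (jetTwo (veroneseMap k ∘ u) x) := by
  have hV : ContDiffAt ℝ 2 (veroneseMap k ∘ u) x := (contDiff_veroneseMap k).contDiffAt.comp x hu
  have hua (a : Fin k) : ContDiffAt ℝ 2 (fun y => u y a) x := contDiffAt_euclidean.1 hu a
  -- A left inverse `K` of the differential turns first derivatives of the components of `u` into
  -- Kronecker deltas.
  obtain ⟨K, hK⟩ := (fderiv ℝ u x).toLinearMap.exists_leftInverse_of_injective
    (LinearMap.ker_eq_bot.2 hinj)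
  have hKJ (i j : Fin n) : ∑ a, K (EuclideanSpace.single a 1) i *
      scalarPartialDeriv j (fun y => u y a) x = if i = j then 1 else 0 := by
    have h1 := LinearMap.congr_fun hK (EuclideanSpace.single j 1)
    have h2 : fderiv ℝ u x (EuclideanSpace.single j 1) =
        ∑ a, scalarPartialDeriv j (fun y => u y a) x •
          (EuclideanSpace.single a 1 : EuclideanSpace ℝ (Fin k)) := by
      ext b
      rw [show fderiv ℝ u x (EuclideanSpace.single j 1) b = partialDeriv j u x b from rfl,
        partialDeriv_apply (hu.differentiableAt two_ne_zero)]
      simp [Pi.single_apply]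
    simp only [LinearMap.comp_apply, ContinuousLinearMap.coe_coe, h2, map_sum, map_smul,
      LinearMap.id_apply] at h1
    have h3 := congrArg (fun v : EuclideanSpace ℝ (Fin n) => v i) h1
    simpa [Pi.single_apply, mul_comm] using h3
  rw [Fintype.linearIndependent_iff]
  intro g hg
  -- A linear relation in the jet is a differential operator `T` without zeroth-order term,
  -- annihilating all `uₐ` and all `uₐ u_b` at `x`.
  let T : (EuclideanSpace ℝ (Fin n) → ℝ) → ℝ := fun h =>
    ∑ i, g (Sum.inl i) * scalarPartialDeriv i h x +
      ∑ p, g (Sum.inr p) * scalarPartialDeriv p.1.1 (scalarPartialDeriv p.1.2 h) x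
  have hT (c) : T (fun y => veroneseMap k (u y) c) = 0 := by
    have h1 := congrArg (EuclideanSpace.proj (𝕜 := ℝ) c) hg
    simp only [map_sum, map_smul, map_zero, map_add, PiLp.proj_apply, smul_eq_mul,
      Fintype.sum_sum_type, jetTwo, Sum.elim_inl, Sum.elim_inr,
      partialDeriv_apply (hV.differentiableAt two_ne_zero),
      partialDeriv_partialDeriv_apply hV] at h1
    exact h1
  have hT1 (a : Fin k) : T (fun y => u y a) = 0 := by
    simpa only [veroneseMap_apply_inl] using hT (Fintype.equivFin _ (Sum.inl a))
  -- In `T(uₐ u_b) - uₐ T(u_b) - u_b T(uₐ)` only the principal symbol of `T`, polarized at `duₐ` and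
  -- `du_b`, survives.
  have hT2 (a b : Fin k) : ∑ p : {p : Fin n × Fin n // p.1 ≤ p.2}, g (Sum.inr p) *
      (scalarPartialDeriv p.1.1 (fun y => u y a) x * scalarPartialDeriv p.1.2 (fun y => u y b) x +
      scalarPartialDeriv p.1.2 (fun y => u y a) x *
        scalarPartialDeriv p.1.1 (fun y => u y b) x) = 0 := by
    have h0 : T (fun y => u y a * u y b) = 0 := by
      simpa only [veroneseMap_apply_inr] using hT (Fintype.equivFin _ (Sum.inr (a, b)))
    have ha := hT1 a
    have hb := hT1 b
    simp only [T] at h0 ha hb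
    simp only [scalarPartialDeriv_mul ((hua a).differentiableAt two_ne_zero)
      ((hua b).differentiableAt two_ne_zero),
      scalarPartialDeriv_scalarPartialDeriv_mul (hua a) (hua b)] at h0
    simp only [mul_add, Finset.sum_add_distrib, mul_left_comm (g _) (u x _), ← Finset.mul_sum]
      at h0 ⊢
    linear_combination h0 - u x a * hb - u x b * ha
  -- Contracting `hT2` with rows `i` and `j` of `K` isolates the coefficient at `(i, j)`, multiplied
  -- by `1` if `i < j` and by `2` if `i = j`.
  have hs (p : {p : Fin n × Fin n // p.1 ≤ p.2}) : g (Sum.inr p) = 0 := by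
    obtain ⟨⟨i, j⟩, hij⟩ := p
    have h0 : ∑ p : {p : Fin n × Fin n // p.1 ≤ p.2}, g (Sum.inr p) *
        ((∑ a, K (EuclideanSpace.single a 1) i * scalarPartialDeriv p.1.1 (fun y => u y a) x) *
          (∑ b, K (EuclideanSpace.single b 1) j * scalarPartialDeriv p.1.2 (fun y => u y b) x) +
        (∑ a, K (EuclideanSpace.single a 1) i * scalarPartialDeriv p.1.2 (fun y => u y a) x) *
          ∑ b, K (EuclideanSpace.single b 1) j *
            scalarPartialDeriv p.1.1 (fun y => u y b) x) = 0 := by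
      have h1 : ∑ a, ∑ b, K (EuclideanSpace.single a 1) i * K (EuclideanSpace.single b 1) j *
          ∑ p : {p : Fin n × Fin n // p.1 ≤ p.2}, g (Sum.inr p) *
          (scalarPartialDeriv p.1.1 (fun y => u y a) x *
            scalarPartialDeriv p.1.2 (fun y => u y b) x +
          scalarPartialDeriv p.1.2 (fun y => u y a) x *
            scalarPartialDeriv p.1.1 (fun y => u y b) x) = 0 := by
        simp only [hT2, mul_zero, Finset.sum_const_zero]
      rw [← h1]
      simp only [Finset.sum_mul_sum]
      simp only [← Finset.sum_add_distrib, Finset.mul_sum]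
      rw [Finset.sum_comm]
      refine Finset.sum_congr rfl fun a _ => ?_
      rw [Finset.sum_comm]
      refine Finset.sum_congr rfl fun b _ => Finset.sum_congr rfl fun p _ => ?_
      ring
    simp only [hKJ] at h0
    rw [Finset.sum_eq_single ⟨(i, j), hij⟩] at h0
    · rcases mul_eq_zero.1 h0 with h | h
      · exact h
      · exfalso
        simp only [if_true] at h
        split_ifs at h <;> norm_num at h
    · rintro ⟨⟨i', j'⟩, h'⟩ - hne
      have h1 : ¬(i = i' ∧ j = j') := by
        rintro ⟨rfl, rfl⟩
        exact hne rfl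
      have h2 : ¬(i = j' ∧ j = i') := by
        rintro ⟨rfl, rfl⟩
        exact h1 ⟨le_antisymm hij h', le_antisymm h' hij⟩
      simp only [mul_ite, mul_one, mul_zero, ← ite_and, and_comm (a := j = _), if_neg h1, if_neg h2,
        add_zero, mul_zero]
    · simp
  have hc (i : Fin n) : g (Sum.inl i) = 0 := by
    have h1 : ∑ a, K (EuclideanSpace.single a 1) i * T (fun y => u y a) = 0 := by
      simp only [hT1, mul_zero, Finset.sum_const_zero]
    simp only [T, hs, zero_mul, Finset.sum_const_zero, add_zero, Finset.mul_sum,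
      mul_left_comm _ (g _)] at h1
    rw [Finset.sum_comm] at h1
    simpa only [← Finset.mul_sum, hKJ, mul_ite, mul_one, mul_zero, Finset.sum_ite_eq,
      Finset.mem_univ, if_true] using h1
  rintro (i | p)
  exacts [hc i, hs p]

/-! ### Free maps on manifolds and independence of the chart -/

section

variable {n : ℕ} {M : Type*} [TopologicalSpace M] [ChartedSpace (EuclideanSpace ℝ (Fin n)) M]

theorem ContMDiff.contDiffAt_comp_symm [IsManifold (𝓡 n) ∞ M] {q : ℕ}
    {F : M → EuclideanSpace ℝ (Fin q)} (hF : ContMDiff (𝓡 n) (𝓡 q) ∞ F)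
    {φ : OpenPartialHomeomorph M (EuclideanSpace ℝ (Fin n))}
    (hφ : φ ∈ IsManifold.maximalAtlas (𝓡 n) ∞ M) {x : EuclideanSpace ℝ (Fin n)}
    (hx : x ∈ φ.target) : ContDiffAt ℝ ∞ (F ∘ φ.symm) x := by
  rw [← contMDiffAt_iff_contDiffAt]
  exact hF.contMDiffAt.comp x
    ((contMDiffOn_symm_of_mem_maximalAtlas hφ).contMDiffAt (φ.open_target.mem_nhds hx))

theorem OpenPartialHomeomorph.mdifferentiable_of_mem_maximalAtlas [IsManifold (𝓡 n) ∞ M]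
    {φ : OpenPartialHomeomorph M (EuclideanSpace ℝ (Fin n))}
    (hφ : φ ∈ IsManifold.maximalAtlas (𝓡 n) ∞ M) : φ.MDifferentiable (𝓡 n) (𝓡 n) :=
  ⟨(contMDiffOn_of_mem_maximalAtlas hφ).mdifferentiableOn (by simp),
    (contMDiffOn_symm_of_mem_maximalAtlas hφ).mdifferentiableOn (by simp)⟩

theorem osculatingSpace_congr {E F : Type*} [NormedAddCommGroup E] [NormedSpace ℝ E]
    [NormedAddCommGroup F] [NormedSpace ℝ F] {f g : E → F} {x : E} (h : f =ᶠ[𝓝 x] g) :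
    osculatingSpace f x = osculatingSpace g x := by
  unfold osculatingSpace
  rw [h.fderiv_eq, h.fderiv.fderiv_eq]

theorem derivSpaceTwo_eq_osculatingSpace [IsManifold (𝓡 n) ∞ M] {q : ℕ}
    {F : M → EuclideanSpace ℝ (Fin q)} (hF : ContMDiff (𝓡 n) (𝓡 q) ∞ F)
    {φ : OpenPartialHomeomorph M (EuclideanSpace ℝ (Fin n))}
    (hφ : φ ∈ IsManifold.maximalAtlas (𝓡 n) ∞ M) {p : M} (hp : p ∈ φ.source) :
    derivSpaceTwo φ F p = osculatingSpace (F ∘ φ.symm) (φ p) := by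
  rw [derivSpaceTwo_eq_span_range, span_range_jetTwo]
  exact (hF.contDiffAt_comp_symm hφ (φ.map_source hp)).of_le ENat.LEInfty.out

/-- The space of derivatives of order at most two does not depend on the chart. -/
theorem derivSpaceTwo_le_of_mem_maximalAtlas [IsManifold (𝓡 n) ∞ M] {q : ℕ}
    {F : M → EuclideanSpace ℝ (Fin q)} (hF : ContMDiff (𝓡 n) (𝓡 q) ∞ F)
    {φ ψ : OpenPartialHomeomorph M (EuclideanSpace ℝ (Fin n))}
    (hφ : φ ∈ IsManifold.maximalAtlas (𝓡 n) ∞ M) (hψ : ψ ∈ IsManifold.maximalAtlas (𝓡 n) ∞ M)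
    {p : M} (hp : p ∈ φ.source) (hp' : p ∈ ψ.source) :
    derivSpaceTwo φ F p ≤ derivSpaceTwo ψ F p := by
  have hτ : ContDiffAt ℝ ∞ (ψ ∘ φ.symm) (φ p) := by
    rw [← contMDiffAt_iff_contDiffAt]
    refine ContMDiffAt.comp (I' := 𝓡 n) (φ p) ?_
      ((contMDiffOn_symm_of_mem_maximalAtlas hφ).contMDiffAt
        (φ.open_target.mem_nhds (φ.map_source hp)))
    rw [φ.left_inv hp]
    exact (contMDiffOn_of_mem_maximalAtlas hψ).contMDiffAt (ψ.open_source.mem_nhds hp')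
  have hval : (ψ ∘ φ.symm) (φ p) = ψ p := congrArg ψ (φ.left_inv hp)
  have hev : F ∘ φ.symm =ᶠ[𝓝 (φ p)] (F ∘ ψ.symm) ∘ (ψ ∘ φ.symm) := by
    have hc : φ.symm ⁻¹' ψ.source ∈ 𝓝 (φ p) := by
      refine (φ.continuousAt_symm (φ.map_source hp)).preimage_mem_nhds ?_
      rw [φ.left_inv hp]
      exact ψ.open_source.mem_nhds hp'
    filter_upwards [hc] with y hy
    simp [ψ.left_inv hy]
  rw [derivSpaceTwo_eq_osculatingSpace hF hφ hp, derivSpaceTwo_eq_osculatingSpace hF hψ hp',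
    osculatingSpace_congr hev, ← hval]
  refine osculatingSpace_comp_le ?_ (hτ.of_le ENat.LEInfty.out)
  rw [hval]
  exact (hF.contDiffAt_comp_symm hψ (ψ.map_source hp')).of_le ENat.LEInfty.out

/-- The composition of an immersion with the Veronese map is a free map. -/
theorem isFreeMap_veroneseMap_comp [IsManifold (𝓡 n) ∞ M] {k : ℕ}
    {e : M → EuclideanSpace ℝ (Fin k)} (he : ContMDiff (𝓡 n) (𝓡 k) ∞ e)
    (hinj : ∀ p, Function.Injective (mfderiv (𝓡 n) (𝓡 k) e p)) :
    IsFreeMap n (veroneseMap k ∘ e) where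
  contMDiff := (contDiff_veroneseMap k).contMDiff.comp he
  finrank_eq p φ hφ hp := by
    rw [finrank_derivSpaceTwo_eq_iff]
    have hd := OpenPartialHomeomorph.mdifferentiable_of_mem_maximalAtlas hφ
    have ht := φ.map_source hp
    refine linearIndependent_jetTwo_veroneseMap_comp (u := e ∘ φ.symm)
      ((he.contDiffAt_comp_symm hφ ht).of_le ENat.LEInfty.out) ?_
    have h1 := mfderiv_comp (I' := 𝓡 n) (φ p) (he.mdifferentiable (by simp) (φ.symm (φ p)))
      (hd.symm.mdifferentiableAt ht)
    rw [mfderiv_eq_fderiv] at h1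
    rw [h1]
    exact (hinj _).comp (hd.symm.mfderiv_injective ht)

theorem fderiv_injective_of_linearIndependent_jetTwo {q : ℕ}
    {f : EuclideanSpace ℝ (Fin n) → EuclideanSpace ℝ (Fin q)} {x : EuclideanSpace ℝ (Fin n)}
    (h : LinearIndependent ℝ (jetTwo f x)) : Function.Injective (fderiv ℝ f x) := by
  refine (injective_iff_map_eq_zero _).2 fun v hv => ?_
  have hsum : v = ∑ i, v i • (EuclideanSpace.single i 1 : EuclideanSpace ℝ (Fin n)) := by
    ext j
    simp [Pi.single_apply]
  rw [hsum] at hv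
  simp only [map_sum, map_smul] at hv
  have h1 := Fintype.linearIndependent_iff.1 (h.comp Sum.inl Sum.inl_injective) v hv
  ext i
  exact h1 i

theorem IsFreeMap.injective_mfderiv [IsManifold (𝓡 n) ∞ M] {q : ℕ}
    {F : M → EuclideanSpace ℝ (Fin q)} (hF : IsFreeMap n F) (p : M) :
    Function.Injective (mfderiv (𝓡 n) (𝓡 q) F p) := by
  let φ := chartAt (EuclideanSpace ℝ (Fin n)) p
  have hφ : φ ∈ IsManifold.maximalAtlas (𝓡 n) ∞ M := IsManifold.chart_mem_maximalAtlas p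
  have hp : p ∈ φ.source := mem_chart_source _ p
  have hd := OpenPartialHomeomorph.mdifferentiable_of_mem_maximalAtlas hφ
  have h1 := mfderiv_comp (I' := 𝓡 n) (I'' := 𝓡 q) p
    (g := F ∘ φ.symm) (f := φ) ((hF.contMDiff.contDiffAt_comp_symm hφ
      (φ.map_source hp)).contMDiffAt.mdifferentiableAt (by simp)) (hd.mdifferentiableAt hp)
  have hev : (F ∘ φ.symm) ∘ φ =ᶠ[𝓝 p] F := by
    filter_upwards [φ.open_source.mem_nhds hp] with y hy
    simp [φ.left_inv hy]
  rw [hev.mfderiv_eq, mfderiv_eq_fderiv] at h1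
  rw [h1]
  exact (fderiv_injective_of_linearIndependent_jetTwo
    ((finrank_derivSpaceTwo_eq_iff φ F p).1 (hF.finrank_eq p φ hφ hp))).comp
    (hd.mfderiv_injective hp)

/-- The image of a free map under a linear map that is injective on all the spaces of derivatives
of order at most two is free. -/
theorem IsFreeMap.clm_comp [IsManifold (𝓡 n) ∞ M] {q r : ℕ}
    {F : M → EuclideanSpace ℝ (Fin q)} (hF : IsFreeMap n F)
    (A : EuclideanSpace ℝ (Fin q) →L[ℝ] EuclideanSpace ℝ (Fin r))
    (hA : ∀ p : M, Disjoint (derivSpaceTwo (chartAt (EuclideanSpace ℝ (Fin n)) p) F p)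
      (LinearMap.ker A.toLinearMap)) :
    IsFreeMap n (A ∘ F) where
  contMDiff := A.contDiff.contMDiff.comp hF.contMDiff
  finrank_eq p φ hφ hp := by
    have hli := hF.finrank_eq p φ hφ hp
    rw [finrank_derivSpaceTwo_eq_iff] at hli ⊢
    rw [Function.comp_assoc, jetTwo_clm_comp
      ((hF.contMDiff.contDiffAt_comp_symm hφ (φ.map_source hp)).of_le
        ENat.LEInfty.out)]
    refine hli.map (f := A.toLinearMap) ((hA p).mono_left ?_)
    rw [← derivSpaceTwo_eq_span_range]
    exact derivSpaceTwo_le_of_mem_maximalAtlas hF.contMDiff hφ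
      (IsManifold.chart_mem_maximalAtlas p) hp (mem_chart_source _ p)

end

/-! ### Dimension counts and generic projection -/

/-- The image of a set under a map that is `C¹` near it has Hausdorff dimension at most the
dimension of the ambient space. -/
theorem dimH_image_le_finrank_of_contDiffAt {E F : Type*} [NormedAddCommGroup E] [NormedSpace ℝ E]
    [FiniteDimensional ℝ E] [NormedAddCommGroup F] [NormedSpace ℝ F] {f : E → F} {s : Set E}
    (hf : ∀ x ∈ s, ContDiffAt ℝ 1 f x) : dimH (f '' s) ≤ Module.finrank ℝ E := by
  refine (dimH_image_le_of_locally_lipschitzOn fun x hx => ?_).trans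
    ((dimH_mono (Set.subset_univ s)).trans (Real.dimH_univ_eq_finrank E).le)
  obtain ⟨K, t, ht, h⟩ := (hf x hx).exists_lipschitzOnWith
  exact ⟨K, t, mem_nhdsWithin_of_mem_nhds ht, h⟩

theorem exists_clm_ker_eq_span_singleton {N : ℕ} {v : EuclideanSpace ℝ (Fin (N + 1))}
    (hv : v ≠ 0) : ∃ A : EuclideanSpace ℝ (Fin (N + 1)) →L[ℝ] EuclideanSpace ℝ (Fin N),
      LinearMap.ker A.toLinearMap = Submodule.span ℝ {v} := by
  have h1 := Submodule.finrank_quotient_add_finrank (Submodule.span ℝ {v})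
  rw [finrank_span_singleton hv, finrank_euclideanSpace_fin] at h1
  have h2 : Module.finrank ℝ (EuclideanSpace ℝ (Fin (N + 1)) ⧸ Submodule.span ℝ {v}) =
      Module.finrank ℝ (EuclideanSpace ℝ (Fin N)) := by
    rw [finrank_euclideanSpace_fin]
    omega
  refine ⟨((LinearEquiv.ofFinrankEq _ _ h2).toLinearMap ∘ₗ
    (Submodule.span ℝ {v}).mkQ).toContinuousLinearMap, ?_⟩
  simp

theorem exists_injective_clm {k r : ℕ} (h : k ≤ r) :
    ∃ A : EuclideanSpace ℝ (Fin k) →L[ℝ] EuclideanSpace ℝ (Fin r), Function.Injective A := by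
  refine ⟨((EuclideanSpace.equiv (Fin r) ℝ).symm.toLinearMap ∘ₗ
    (Function.ExtendByZero.linearMap ℝ (Fin.castLE h)) ∘ₗ
    (EuclideanSpace.equiv (Fin k) ℝ).toLinearMap).toContinuousLinearMap, fun y z hyz => ?_⟩
  ext i
  have h1 := congrArg (fun w : EuclideanSpace ℝ (Fin r) => w (Fin.castLE h i)) hyz
  simpa [(Fin.castLE_injective h).extend_apply] using h1

section

variable {n : ℕ} {M : Type*} [TopologicalSpace M] [ChartedSpace (EuclideanSpace ℝ (Fin n)) M]
  [IsManifold (𝓡 n) ∞ M]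

theorem ContDiffAt.contDiffAt_jetTwo {q : ℕ}
    {f : EuclideanSpace ℝ (Fin n) → EuclideanSpace ℝ (Fin q)} {x : EuclideanSpace ℝ (Fin n)}
    (hf : ContDiffAt ℝ ∞ f x) (c : JetIndex n) :
    ContDiffAt ℝ ∞ (fun y => jetTwo f y c) x := by
  have hpd (g : EuclideanSpace ℝ (Fin n) → EuclideanSpace ℝ (Fin q)) (hg : ContDiffAt ℝ ∞ g x)
      (i : Fin n) : ContDiffAt ℝ ∞ (partialDeriv i g) x :=
    (hg.fderiv_right (m := ∞) (by simp)).clm_apply contDiffAt_const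
  rcases c with i | p
  · exact hpd f hf i
  · exact hpd _ (hpd f hf _) _

/-- The vectors tangent to second order to the image of `F`, over one chart. -/
theorem dimH_iUnion_derivSpaceTwo_le {q : ℕ} {F : M → EuclideanSpace ℝ (Fin q)}
    (hF : ContMDiff (𝓡 n) (𝓡 q) ∞ F) {φ : OpenPartialHomeomorph M (EuclideanSpace ℝ (Fin n))}
    (hφ : φ ∈ IsManifold.maximalAtlas (𝓡 n) ∞ M) :
    dimH (⋃ p ∈ φ.source, (derivSpaceTwo φ F p : Set (EuclideanSpace ℝ (Fin q)))) ≤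
      (n * (n + 5) / 2 : ℕ) := by
  -- Parameters: `n` for the base point and `n(n+3)/2` for the coefficients of the jet vectors.
  let G : EuclideanSpace ℝ (Fin n) × (JetIndex n → ℝ) → EuclideanSpace ℝ (Fin q) :=
    fun z => ∑ c, z.2 c • jetTwo (F ∘ φ.symm) z.1 c
  have hG : ∀ z ∈ φ.target ×ˢ (Set.univ : Set (JetIndex n → ℝ)), ContDiffAt ℝ 1 G z := by
    rintro ⟨x, a⟩ ⟨hx, -⟩
    refine ContDiffAt.sum fun c _ => ContDiffAt.fun_smul ?_ ?_
    · exact ((contDiff_apply ℝ ℝ c).comp contDiff_snd).contDiffAt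
    · exact (((hF.contDiffAt_comp_symm hφ hx).contDiffAt_jetTwo c).of_le
        ENat.LEInfty.out).comp (x, a) contDiffAt_fst
  have hdim : Module.finrank ℝ (EuclideanSpace ℝ (Fin n) × (JetIndex n → ℝ)) =
      n * (n + 5) / 2 := by
    rw [Module.finrank_prod, finrank_euclideanSpace_fin, Module.finrank_fintype_fun_eq_card,
      card_jetIndex, show n * (n + 5) = n * (n + 3) + n * 2 by ring,
      Nat.add_mul_div_right _ _ two_pos, add_comm]
  refine (dimH_mono ?_).trans ((dimH_image_le_finrank_of_contDiffAt hG).trans_eq (by rw [hdim]))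
  refine Set.iUnion₂_subset fun p hp w hw => ?_
  rw [derivSpaceTwo_eq_span_range, SetLike.mem_coe, Submodule.mem_span_range_iff_exists_fun] at hw
  obtain ⟨a, ha⟩ := hw
  exact ⟨(φ p, a), ⟨φ.map_source hp, trivial⟩, ha⟩

/-- The multiples of the secants of the image of `F`, over a pair of charts. -/
theorem dimH_secants_le {q : ℕ} {F : M → EuclideanSpace ℝ (Fin q)}
    (hF : ContMDiff (𝓡 n) (𝓡 q) ∞ F) {φ ψ : OpenPartialHomeomorph M (EuclideanSpace ℝ (Fin n))}
    (hφ : φ ∈ IsManifold.maximalAtlas (𝓡 n) ∞ M) (hψ : ψ ∈ IsManifold.maximalAtlas (𝓡 n) ∞ M) :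
    dimH {w | ∃ p ∈ φ.source, ∃ p' ∈ ψ.source, ∃ t : ℝ, w = t • (F p - F p')} ≤
      (2 * n + 1 : ℕ) := by
  let G : (EuclideanSpace ℝ (Fin n) × EuclideanSpace ℝ (Fin n)) × ℝ → EuclideanSpace ℝ (Fin q) :=
    fun z => z.2 • ((F ∘ φ.symm) z.1.1 - (F ∘ ψ.symm) z.1.2)
  have hG : ∀ z ∈ (φ.target ×ˢ ψ.target) ×ˢ (Set.univ : Set ℝ), ContDiffAt ℝ 1 G z := by
    rintro ⟨⟨x, y⟩, t⟩ ⟨⟨hx, hy⟩, -⟩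
    refine ContDiffAt.smul contDiffAt_snd (ContDiffAt.sub ?_ ?_)
    · exact ContDiffAt.comp (n := 1) ((x, y), t) (g := F ∘ φ.symm) (f := fun z => z.1.1)
        ((hF.contDiffAt_comp_symm hφ hx).of_le ENat.LEInfty.out)
        (contDiff_fst.comp contDiff_fst).contDiffAt
    · exact ContDiffAt.comp (n := 1) ((x, y), t) (g := F ∘ ψ.symm) (f := fun z => z.1.2)
        ((hF.contDiffAt_comp_symm hψ hy).of_le ENat.LEInfty.out)
        (contDiff_snd.comp contDiff_fst).contDiffAt
  have hdim : Module.finrank ℝ ((EuclideanSpace ℝ (Fin n) × EuclideanSpace ℝ (Fin n)) × ℝ) =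
      2 * n + 1 := by
    rw [Module.finrank_prod, Module.finrank_prod, finrank_euclideanSpace_fin, Module.finrank_self,
      two_mul]
  refine (dimH_mono ?_).trans ((dimH_image_le_finrank_of_contDiffAt hG).trans_eq (by rw [hdim]))
  rintro _ ⟨p, hp, p', hp', t, rfl⟩
  refine ⟨((φ p, ψ p'), t), ⟨⟨φ.map_source hp, ψ.map_source hp'⟩, trivial⟩, ?_⟩
  simp [G, φ.left_inv hp, ψ.left_inv hp']

/-- A free injective map into a space of large dimension can be projected to a hyperplane. -/
theorem exists_isFreeMap_injective_of_succ [CompactSpace M] (hn : 1 ≤ n) {N : ℕ}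
    (hN : n * (n + 5) / 2 ≤ N) {F : M → EuclideanSpace ℝ (Fin (N + 1))} (hF : IsFreeMap n F)
    (hinj : Function.Injective F) :
    ∃ G : M → EuclideanSpace ℝ (Fin N), IsFreeMap n G ∧ Function.Injective G := by
  let ch : M → OpenPartialHomeomorph M (EuclideanSpace ℝ (Fin n)) := chartAt _
  have hch (p : M) : ch p ∈ IsManifold.maximalAtlas (𝓡 n) ∞ M :=
    IsManifold.chart_mem_maximalAtlas p
  -- Finitely many charts suffice, so the bad directions form a finite union of sets whose dimension
  -- is controlled.
  obtain ⟨t, ht⟩ := CompactSpace.elim_nhds_subcover (fun p => (ch p).source)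
    fun p => chart_source_mem_nhds _ p
  have hcover (p : M) : ∃ a ∈ t, p ∈ (ch a).source := by
    simpa using (ht.ge (Set.mem_univ p) : p ∈ ⋃ x ∈ t, (ch x).source)
  let S₁ : Set (EuclideanSpace ℝ (Fin (N + 1))) :=
    ⋃ a ∈ (t : Set M), ⋃ p ∈ (ch a).source, derivSpaceTwo (ch a) F p
  let S₂ : Set (EuclideanSpace ℝ (Fin (N + 1))) :=
    ⋃ a ∈ (t : Set M), ⋃ b ∈ (t : Set M),
      {w | ∃ p ∈ (ch a).source, ∃ p' ∈ (ch b).source, ∃ t : ℝ, w = t • (F p - F p')}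
  -- Here `n ≥ 1` is needed; equality holds for `n = 1`.
  have h2n : 2 * n + 1 ≤ n * (n + 5) / 2 := by
    rw [Nat.le_div_iff_mul_le two_pos]
    nlinarith
  -- Adjoining `0` matters only for empty `M`; otherwise `S₁` already contains it.
  have hS : dimH ({0} ∪ (S₁ ∪ S₂)) ≤ (N : ℕ) := by
    rw [dimH_union, dimH_union, dimH_singleton]
    refine max_le zero_le (max_le ?_ ?_)
    · rw [dimH_bUnion t.countable_toSet]
      refine iSup₂_le fun a _ => (dimH_iUnion_derivSpaceTwo_le hF.contMDiff (hch a)).trans ?_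
      exact_mod_cast hN
    · rw [dimH_bUnion t.countable_toSet]
      refine iSup₂_le fun a _ => ?_
      rw [dimH_bUnion t.countable_toSet]
      refine iSup₂_le fun b _ => (dimH_secants_le hF.contMDiff (hch a) (hch b)).trans ?_
      exact_mod_cast h2n.trans hN
  have hlt : dimH ({0} ∪ (S₁ ∪ S₂)) <
      Module.finrank ℝ (EuclideanSpace ℝ (Fin (N + 1))) := by
    rw [finrank_euclideanSpace_fin]
    exact hS.trans_lt (by exact_mod_cast N.lt_succ_self)
  obtain ⟨v, hv⟩ := (dense_compl_of_dimH_lt_finrank hlt).nonempty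
  simp only [Set.mem_compl_iff, Set.mem_union, Set.mem_singleton_iff, not_or] at hv
  obtain ⟨hv0, hv1, hv2⟩ := hv
  obtain ⟨A, hA⟩ := exists_clm_ker_eq_span_singleton hv0
  refine ⟨A ∘ F, hF.clm_comp A fun p => ?_, fun p p' hpp => ?_⟩
  · rw [hA, Submodule.disjoint_span_singleton' hv0]
    intro hmem
    obtain ⟨a, ha, hpa⟩ := hcover p
    refine hv1 (Set.mem_biUnion (Finset.mem_coe.2 ha) (Set.mem_biUnion hpa ?_))
    exact derivSpaceTwo_le_of_mem_maximalAtlas hF.contMDiff (hch p) (hch a)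
      (mem_chart_source _ p) hpa hmem
  · have hker : F p - F p' ∈ LinearMap.ker A.toLinearMap := by
      simpa [sub_eq_zero] using hpp
    rw [hA, Submodule.mem_span_singleton] at hker
    obtain ⟨c, hc⟩ := hker
    -- A nonzero `c` would make `v = c⁻¹ • (F p - F p')` a multiple of a secant.
    by_cases h0 : c = 0
    · rw [h0, zero_smul] at hc
      exact hinj (sub_eq_zero.1 hc.symm)
    · exfalso
      obtain ⟨a, ha, hpa⟩ := hcover p
      obtain ⟨b, hb, hpb⟩ := hcover p'
      refine hv2 (Set.mem_biUnion (Finset.mem_coe.2 ha) (Set.mem_biUnion (Finset.mem_coe.2 hb) ?_))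
      exact ⟨p, hpa, p', hpb, c⁻¹, by rw [← hc, inv_smul_smul₀ h0]⟩

/-- A compact `n`-manifold admits a free injective map into the space of dimension
`n (n + 5) / 2`. -/
theorem exists_isFreeMap_injective [CompactSpace M] [T2Space M] (hn : 1 ≤ n) :
    ∃ F : M → EuclideanSpace ℝ (Fin (n * (n + 5) / 2)),
      IsFreeMap n F ∧ Function.Injective F := by
  obtain ⟨k, e, he, hemb, himm⟩ := exists_embedding_euclidean_of_compact (I := 𝓡 n) (M := M)
  obtain ⟨N, F, hF, hinj⟩ : ∃ (N : ℕ) (F : M → EuclideanSpace ℝ (Fin N)),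
      IsFreeMap n F ∧ Function.Injective F :=
    ⟨_, _, isFreeMap_veroneseMap_comp he himm, (veroneseMap_injective k).comp hemb.injective⟩
  -- Padding by zeros writes the dimension as `n(n+5)/2 + m`, even if `N` is small, so that
  -- induction on `m` can remove the surplus.
  have hpad : ∃ (m : ℕ) (F : M → EuclideanSpace ℝ (Fin (n * (n + 5) / 2 + m))),
      IsFreeMap n F ∧ Function.Injective F := by
    obtain ⟨A, hA⟩ := exists_injective_clm (Nat.le_add_left N (n * (n + 5) / 2))
    refine ⟨N, A ∘ F, hF.clm_comp A fun p => ?_, hA.comp hinj⟩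
    rw [LinearMap.ker_eq_bot.2 (show Function.Injective A.toLinearMap from hA)]
    exact disjoint_bot_right
  obtain ⟨m, h⟩ := hpad
  induction m with
  | zero => exact h
  | succ m ih =>
    obtain ⟨G, hG, hGinj⟩ := h
    exact ih (exists_isFreeMap_injective_of_succ hn (Nat.le_add_right _ m) hG hGinj)

end

/-! ### The pullback metric and its comparison with `g` -/

section

variable {n : ℕ} {M : Type*} [TopologicalSpace M] [ChartedSpace (EuclideanSpace ℝ (Fin n)) M]

/-- The symmetric bilinear form `(v, w) ↦ ⟪D v, D w⟫`. -/
noncomputable def gramForm {E F : Type*} [NormedAddCommGroup E] [NormedSpace ℝ E]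
    [NormedAddCommGroup F] [InnerProductSpace ℝ F] (D : E →L[ℝ] F) : E →L[ℝ] E →L[ℝ] ℝ :=
  ((ContinuousLinearMap.compL ℝ E F ℝ).flip D).comp ((innerSL ℝ).comp D)

theorem gramForm_apply {E F : Type*} [NormedAddCommGroup E] [NormedSpace ℝ E]
    [NormedAddCommGroup F] [InnerProductSpace ℝ F] (D : E →L[ℝ] F) (v w : E) :
    gramForm D v w = inner ℝ (D v) (D w) := rfl

set_option synthInstance.maxHeartbeats 100000 in
theorem contDiff_gramForm {E F : Type*} [NormedAddCommGroup E] [NormedSpace ℝ E]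
    [NormedAddCommGroup F] [InnerProductSpace ℝ F] {m : WithTop ℕ∞} :
    ContDiff ℝ m (gramForm : (E →L[ℝ] F) → E →L[ℝ] E →L[ℝ] ℝ) :=
  ContDiff.clm_comp (g := fun D => (ContinuousLinearMap.compL ℝ E F ℝ).flip D)
    (f := fun D => (innerSL ℝ).comp D) (ContinuousLinearMap.contDiff _)
    (contDiff_const.clm_comp contDiff_id)

/-- The differential of a map into a Euclidean space, as a map with values in this space. -/
noncomputable def euclideanDifferential {q : ℕ} (F : M → EuclideanSpace ℝ (Fin q)) (p : M) :
    TangentSpace (𝓡 n) p →L[ℝ] EuclideanSpace ℝ (Fin q) :=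
  mfderiv (𝓡 n) (𝓡 q) F p

/-- The pullback of the standard metric as a family of bilinear forms. -/
noncomputable def pullbackForm {q : ℕ} (F : M → EuclideanSpace ℝ (Fin q)) (p : M) :
    TangentSpace (𝓡 n) p →L[ℝ] TangentSpace (𝓡 n) p →L[ℝ] ℝ :=
  gramForm (E := EuclideanSpace ℝ (Fin n)) (euclideanDifferential F p)

theorem pullbackForm_eq_inner {q : ℕ} (F : M → EuclideanSpace ℝ (Fin q)) (p : M)
    (X Y : TangentSpace (𝓡 n) p) : pullbackForm F p X Y =
      inner ℝ (euclideanDifferential F p X) (euclideanDifferential F p Y) := rfl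

theorem pullbackForm_self {q : ℕ} (F : M → EuclideanSpace ℝ (Fin q)) (p : M)
    (X : TangentSpace (𝓡 n) p) : pullbackForm F p X X = ‖euclideanDifferential F p X‖ ^ 2 :=
  real_inner_self_eq_norm_sq (euclideanDifferential F p X)

theorem pullbackForm_smul {q : ℕ} {F : M → EuclideanSpace ℝ (Fin q)}
    (hF : ContMDiff (𝓡 n) (𝓡 q) ∞ F) (ε : ℝ) (p : M) (X : TangentSpace (𝓡 n) p) :
    pullbackForm (ε • F) p X X = ε ^ 2 * pullbackForm F p X X := by
  have h1 : euclideanDifferential (ε • F) p = ε • euclideanDifferential F p :=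
    const_smul_mfderiv (hF.mdifferentiable (by simp) p) ε
  rw [pullbackForm_self, pullbackForm_self, h1, smul_apply, norm_smul, mul_pow, Real.norm_eq_abs,
    sq_abs]

variable [IsManifold (𝓡 n) ∞ M]

/-- The differential of `F` at `p` read in the trivialization of the tangent bundle around `x`. -/
theorem inTangentCoordinates_apply_eq_euclideanDifferential {q : ℕ}
    (F : M → EuclideanSpace ℝ (Fin q)) {x p : M}
    (hp : p ∈ (trivializationAt (EuclideanSpace ℝ (Fin n))
      (fun p : M => TangentSpace (𝓡 n) p) x).baseSet) (v : EuclideanSpace ℝ (Fin n)) :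
    inTangentCoordinates (𝓡 n) (𝓡 q) id F (fun p => mfderiv (𝓡 n) (𝓡 q) F p) x p v =
      euclideanDifferential F p ((trivializationAt (EuclideanSpace ℝ (Fin n))
        (fun p : M => TangentSpace (𝓡 n) p) x).symm p v) := by
  change (trivializationAt (EuclideanSpace ℝ (Fin q)) (TangentSpace (𝓡 q)) (F x)).continuousLinearMapAt
    ℝ (F p) (mfderiv (𝓡 n) (𝓡 q) F p (Trivialization.symmL ℝ _ p v)) = _
  rw [TangentBundle.continuousLinearMapAt_model_space]
  exact congrArg (euclideanDifferential F p) (Trivialization.symmL_apply _ hp v)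

/-- In a trivialization this section is the quadratic map `gramForm` applied to the coordinate form
of the differential, which is smooth. -/
theorem contMDiff_pullbackForm {q : ℕ} {F : M → EuclideanSpace ℝ (Fin q)}
    (hF : ContMDiff (𝓡 n) (𝓡 q) ∞ F) :
    ContMDiff (𝓡 n) ((𝓡 n).prod 𝓘(ℝ, EuclideanSpace ℝ (Fin n) →L[ℝ]
      EuclideanSpace ℝ (Fin n) →L[ℝ] ℝ)) ∞
      (fun p : M => TotalSpace.mk' (EuclideanSpace ℝ (Fin n) →L[ℝ]
        EuclideanSpace ℝ (Fin n) →L[ℝ] ℝ)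
        (E := fun p : M => TangentSpace (𝓡 n) p →L[ℝ] TangentSpace (𝓡 n) p →L[ℝ] ℝ)
        p (pullbackForm F p)) := by
  intro x
  rw [contMDiffAt_section]
  have h1 := (hF.contMDiffAt (x := x)).mfderiv_const (m := ∞) (by simp)
  refine (contDiff_gramForm.contMDiff.contMDiffAt.comp x h1).congr_of_eventuallyEq ?_
  have hb := (trivializationAt (EuclideanSpace ℝ (Fin n))
    (fun p : M => TangentSpace (𝓡 n) p) x).open_baseSet.mem_nhds
    (FiberBundle.mem_baseSet_trivializationAt' x)
  filter_upwards [hb] with p hp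
  ext1 v
  ext1 w
  rw [hom_trivializationAt_apply]
  dsimp only
  rw [inCoordinates_apply_eq₂ hp hp (Set.mem_univ _)]
  simp only [Function.comp_apply, gramForm_apply,
    inTangentCoordinates_apply_eq_euclideanDifferential F hp]
  rw [Trivialization.coe_linearMapAt_of_mem _ (Set.mem_univ p)]
  rfl

/-- Near `x` the differential is the composite of the trivialization, bounded for the norm of `g`,
and its coordinate expression, bounded by continuity. -/
theorem exists_eventually_pullbackForm_le {q : ℕ} {F : M → EuclideanSpace ℝ (Fin q)}
    (hF : ContMDiff (𝓡 n) (𝓡 q) ∞ F)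
    (g : ContMDiffRiemannianMetric (𝓡 n) ∞ (EuclideanSpace ℝ (Fin n))
      (fun p : M ↦ TangentSpace (𝓡 n) p)) (x : M) :
    ∃ C : ℝ, ∀ᶠ p in 𝓝 x, ∀ X : TangentSpace (𝓡 n) p,
      pullbackForm F p X X ≤ C * g.inner p X X := by
  let : RiemannianBundle (fun p : M ↦ TangentSpace (𝓡 n) p) := ⟨g.toRiemannianMetric⟩
  have : IsContinuousRiemannianBundle (EuclideanSpace ℝ (Fin n))
      (fun p : M ↦ TangentSpace (𝓡 n) p) :=
    ⟨⟨g.inner, g.contMDiff.continuous, fun _ _ _ => rfl⟩⟩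
  obtain ⟨C, -, hC⟩ := eventually_norm_trivializationAt_lt (EuclideanSpace ℝ (Fin n))
    (fun p : M ↦ TangentSpace (𝓡 n) p) x
  have hD := ((hF.contMDiffAt (x := x)).mfderiv_const (m := ∞) (by simp)).continuousAt.norm
  have hb := (trivializationAt (EuclideanSpace ℝ (Fin n))
    (fun p : M => TangentSpace (𝓡 n) p) x).open_baseSet.mem_nhds
    (FiberBundle.mem_baseSet_trivializationAt' x)
  set K := ‖inTangentCoordinates (𝓡 n) (𝓡 q) id F (fun p => mfderiv (𝓡 n) (𝓡 q) F p) x x‖ + 1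
  refine ⟨(K * C) ^ 2, ?_⟩
  filter_upwards [hC, hb, hD.eventually (gt_mem_nhds (lt_add_one _))] with p hCp hp hDp X
  have hX : euclideanDifferential F p X = inTangentCoordinates (𝓡 n) (𝓡 q) id F
      (fun p => mfderiv (𝓡 n) (𝓡 q) F p) x p ((trivializationAt (EuclideanSpace ℝ (Fin n))
        (fun p : M => TangentSpace (𝓡 n) p) x).continuousLinearMapAt ℝ p X) := by
    rw [inTangentCoordinates_apply_eq_euclideanDifferential F hp,
      ← Trivialization.symmL_apply (R := ℝ) _ hp]
    exact congrArg _ (Trivialization.symmL_continuousLinearMapAt _ hp X).symm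
  have hle : ‖euclideanDifferential F p X‖ ≤ K * C * ‖X‖ := by
    rw [hX, mul_assoc]
    refine (ContinuousLinearMap.le_opNorm _ _).trans ?_
    refine mul_le_mul hDp.le ?_ (norm_nonneg _) (by positivity)
    exact (ContinuousLinearMap.le_opNorm _ _).trans
      (mul_le_mul_of_nonneg_right hCp.le (norm_nonneg _))
  have hg : g.inner p X X = ‖X‖ ^ 2 := real_inner_self_eq_norm_sq X
  rw [hg, pullbackForm_self, ← mul_pow]
  exact pow_le_pow_left₀ (norm_nonneg _) hle 2

theorem exists_pullbackForm_le [CompactSpace M] {q : ℕ} {F : M → EuclideanSpace ℝ (Fin q)}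
    (hF : ContMDiff (𝓡 n) (𝓡 q) ∞ F)
    (g : ContMDiffRiemannianMetric (𝓡 n) ∞ (EuclideanSpace ℝ (Fin n))
      (fun p : M ↦ TangentSpace (𝓡 n) p)) :
    ∃ C : ℝ, 1 ≤ C ∧ ∀ (p : M) (X : TangentSpace (𝓡 n) p),
      pullbackForm F p X X ≤ C * g.inner p X X := by
  choose C hC using exists_eventually_pullbackForm_le hF g
  obtain ⟨t, ht⟩ := CompactSpace.elim_nhds_subcover _ hC
  -- This sum dominates all the local constants; the summand `1` secures `1 ≤ C`, which the final
  -- scaling uses.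
  have hle (x : M) (hx : x ∈ t) : C x ≤ 1 + ∑ y ∈ t, |C y| :=
    (le_abs_self _).trans ((Finset.single_le_sum (f := fun y => |C y|)
      (fun y _ => abs_nonneg _) hx).trans (le_add_of_nonneg_left zero_le_one))
  refine ⟨1 + ∑ y ∈ t, |C y|, le_add_of_nonneg_right (Finset.sum_nonneg fun _ _ => abs_nonneg _),
    fun p X => ?_⟩
  obtain ⟨x, hx, hpx⟩ := Set.mem_iUnion₂.1 (ht.ge (Set.mem_univ p))
  have hg : 0 ≤ g.inner p X X := by
    rcases eq_or_ne X 0 with rfl | h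
    · simp
    · exact (g.pos p X h).le
  exact (hpx X).trans (mul_le_mul_of_nonneg_right (hle x hx) hg)

/-- If the pullback of the standard metric is at most half of `g`, then the difference is a
Riemannian metric. -/
theorem exists_metric_eq_sub_pullbackCan {q : ℕ} {F : M → EuclideanSpace ℝ (Fin q)}
    (hF : ContMDiff (𝓡 n) (𝓡 q) ∞ F)
    (g : ContMDiffRiemannianMetric (𝓡 n) ∞ (EuclideanSpace ℝ (Fin n))
      (fun p : M ↦ TangentSpace (𝓡 n) p))
    (hle : ∀ (p : M) (X : TangentSpace (𝓡 n) p), 2 * pullbackForm F p X X ≤ g.inner p X X) :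
    ∃ h : ContMDiffRiemannianMetric (𝓡 n) ∞ (EuclideanSpace ℝ (Fin n))
      (fun p : M ↦ TangentSpace (𝓡 n) p), ∀ (p : M) (X Y : TangentSpace (𝓡 n) p),
        h.inner p X Y = g.inner p X Y - pullbackCan n F p X Y := by
  refine ⟨{
    inner := fun p => g.inner p - pullbackForm F p
    symm := fun p v w => ?_
    pos := fun p v hv => ?_
    isVonNBounded := fun p => ?_
    contMDiff := g.contMDiff.sub_section (contMDiff_pullbackForm hF) }, fun p X Y => rfl⟩
  · change g.inner p v w - pullbackForm F p v w = g.inner p w v - pullbackForm F p w v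
    rw [g.symm, pullbackForm_eq_inner, pullbackForm_eq_inner, real_inner_comm]
  · change 0 < g.inner p v v - pullbackForm F p v v
    linarith [g.pos p v hv, hle p v]
  -- Since `g - F^*g^can ≥ g / 2`, the unit ball of the difference lies in twice the unit ball of
  -- `g`.
  · refine ((g.isVonNBounded p).image
      ((2 : ℝ) • ContinuousLinearMap.id ℝ (TangentSpace (𝓡 n) p))).subset fun v hv => ?_
    have hv' : g.inner p v v - pullbackForm F p v v < 1 := hv
    refine ⟨(2 : ℝ)⁻¹ • v, ?_, smul_inv_smul₀ (two_ne_zero (α := ℝ)) v⟩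
    change g.inner p ((2 : ℝ)⁻¹ • v) ((2 : ℝ)⁻¹ • v) < 1
    simp only [map_smul, smul_apply, smul_eq_mul]
    linarith [hle p v]

theorem IsFreeMap.isFreeEmbedding [CompactSpace M] {q : ℕ} {F : M → EuclideanSpace ℝ (Fin q)}
    (hF : IsFreeMap n F) (hinj : Function.Injective F) : IsFreeEmbedding n F where
  toIsFreeMap := hF
  injective_mfderiv := hF.injective_mfderiv
  isEmbedding := (hF.contMDiff.continuous.isClosedEmbedding hinj).isEmbedding

end

theorem mainTheorem7 (n : ℕ) (hn : 1 ≤ n) {M : Type*} [TopologicalSpace M] [T2Space M]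
    [CompactSpace M] [ChartedSpace (EuclideanSpace ℝ (Fin n)) M] [IsManifold (𝓡 n) ∞ M]
    (g : Bundle.ContMDiffRiemannianMetric (𝓡 n) ∞ (EuclideanSpace ℝ (Fin n))
      (fun p : M ↦ TangentSpace (𝓡 n) p)) :
    ∃ F₀ : M → EuclideanSpace ℝ (Fin (n * (n + 5) / 2)),
      IsFreeEmbedding n F₀ ∧
      ∃ h : Bundle.ContMDiffRiemannianMetric (𝓡 n) ∞ (EuclideanSpace ℝ (Fin n))
          (fun p : M ↦ TangentSpace (𝓡 n) p),
        ∀ (p : M) (X Y : TangentSpace (𝓡 n) p),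
          h.inner p X Y = g.inner p X Y - pullbackCan n F₀ p X Y := by
  obtain ⟨F, hF, hinj⟩ := exists_isFreeMap_injective (M := M) hn
  obtain ⟨C, hC, hle⟩ := exists_pullbackForm_le hF.contMDiff g
  -- With `ε = (2C)⁻¹` the requirement `2 ε² C ≤ 1` becomes `(2C)⁻¹ ≤ 1`, which follows from `C ≥
  -- 1`.
  have hε : (2 * C)⁻¹ ≠ 0 := by positivity
  have hsmul : Function.Injective (((2 * C)⁻¹ : ℝ) •
      ContinuousLinearMap.id ℝ (EuclideanSpace ℝ (Fin (n * (n + 5) / 2)))) :=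
    smul_right_injective _ hε
  have hfree : IsFreeMap n ((2 * C)⁻¹ • F) := by
    refine hF.clm_comp (((2 * C)⁻¹ : ℝ) • ContinuousLinearMap.id ℝ _) fun p => ?_
    rw [LinearMap.ker_eq_bot.2 hsmul]
    exact disjoint_bot_right
  refine ⟨(2 * C)⁻¹ • F, hfree.isFreeEmbedding (hsmul.comp hinj),
    exists_metric_eq_sub_pullbackCan hfree.contMDiff g fun p X => ?_⟩
  have hF0 : 0 ≤ pullbackForm F p X X := by
    rw [pullbackForm_self]
    positivity
  rw [pullbackForm_smul hF.contMDiff]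
  have h1 : 2 * ((2 * C)⁻¹ ^ 2 * pullbackForm F p X X) ≤
      2 * ((2 * C)⁻¹ ^ 2 * (C * g.inner p X X)) := by
    gcongr
    exact hle p X
  have hg0 : 0 ≤ g.inner p X X := by nlinarith [hle p X]
  refine h1.trans ?_
  have h2 : 2 * ((2 * C)⁻¹ ^ 2 * (C * g.inner p X X)) = (2 * C)⁻¹ * g.inner p X X := by
    field_simp
  rw [h2]
  exact mul_le_of_le_one_left hg0 (inv_le_one_of_one_le₀ (by linarith))
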